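/- Let $S$ be a countable set of colours and let $R=(R(u,v))_{u,v\in S}$ be a stochastic matrix (nonnegative entries, all row sums equal to $1$) that is irreducible, aperiodic and positive recurrent, with stationary distribution $\pi$ (so $\pi R=\pi$), and uniformly ergodic: there are constants $C>0$ and $0<\rho<1$ such that $|R^n(u,v)-\pi_v|\le C\rho^n$ for all $n\ge 1$ and all $u,v\in S$. Let $U_0=(U_{0,v})_{v\in S}$ be a non-random vector with nonnegative entries and total mass $\sum_{v\in S}U_{0,v}=t\in(0,\infty)$. Consider the urn process with initial configuration $U_0$ and replacement matrix $R$, that is, random configurations $(U_n)_{n\ge0}$ and random colours $(Z_n)_{n\ge0}$ in $S$ such that for all $n\ge0$ and $z\in S$ $$\mathbb P\bigl(Z_n=z\mid U_0,\dots,U_n,\,Z_0,\dots,Z_{n-1}\bigr)=\frac{U_{n,z}}{n+t}\ \text{ a.s.},\qquad U_{n+1}=U_n+R_{Z_n},$$ where $R_z$ is the $z$-th row of $R$. Then, as $n\to\infty$: (i) $\dfrac{U_n}{n+t}\to\pi$ almost surely, coordinatewise and also in $\ell^1(S)$; (ii) with $N_{n,v}:=\sum_{k=0}^{n}\mathbf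 1_{\{Z_k=v\}}$ for $v\in S$, $\dfrac{N_{n,v}}{n+1}\to\pi_v$ almost surely, where the convergence is coordinatewise and also in $\ell^1(S)$, i.e. almost surely $\sum_{v\in S}\bigl|\tfrac{N_{n,v}}{n+1}-\pi_v\bigr|\to0$. -/

import Mathlib

open Filter Topology MeasureTheory

/-- `R` is a stochastic matrix on `S`: nonnegative entries, and every row sums to one. -/
structure IsStochasticMatrix {S : Type*} (R : Matrix S S ℝ) : Prop where
  nonneg : ∀ u v, 0 ≤ R u v
  hasSum_row : ∀ u, HasSum (fun v => R u v) 1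

open Classical in
/-- The `n`-step transition matrix `R ^ n` of a stochastic matrix with a possibly infinite
index set (all the sums converge for a stochastic `R`). -/
noncomputable def nStep {S : Type*} (R : Matrix S S ℝ) : ℕ → Matrix S S ℝ
  | 0 => fun u v => if u = v then 1 else 0
  | n + 1 => fun u v => ∑' w, R u w * nStep R n w v

/-- Every state has period one: the only common divisor of the times `n ≥ 1` at which a return
to the state has positive probability is `1`. -/
def IsAperiodicMatrix {S : Type*} (R : Matrix S S ℝ) : Prop :=
  ∀ v : S, ∀ d : ℕ, (∀ n : ℕ, 1 ≤ n → 0 < nStep R n v v → d ∣ n) → d = 1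

open Classical in
/-- `firstPassage R v n u` is the probability that the chain started at `u` visits `v` at time
`n + 1` and at none of the times `1, …, n`. -/
noncomputable def firstPassage {S : Type*} (R : Matrix S S ℝ) (v : S) : ℕ → S → ℝ
  | 0 => fun u => R u v
  | n + 1 => fun u => ∑' w, if w = v then 0 else R u w * firstPassage R v n w

/-- Every state is recurrent (the return time is almost surely finite) and has a finite
expected return time. -/
def IsPositiveRecurrent {S : Type*} (R : Matrix S S ℝ) : Prop :=
  ∀ v : S, HasSum (fun n => firstPassage R v n v) 1 ∧
    Summable (fun n : ℕ => ((n : ℝ) + 1) * firstPassage R v n v)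

/-- `π` is a stationary distribution of `R`: a probability vector with `π R = π`. -/
structure IsStationaryDistribution {S : Type*} (R : Matrix S S ℝ) (π : S → ℝ) : Prop where
  nonneg : ∀ v, 0 ≤ π v
  hasSum_one : HasSum π 1
  invariant : ∀ v, HasSum (fun u => π u * R u v) (π v)

/-- The chain with transition matrix `R` converges to `π` geometrically fast, uniformly in the
initial and the final state. -/
def IsUniformlyErgodic {S : Type*} (R : Matrix S S ℝ) (π : S → ℝ) : Prop :=
  ∃ ρ C : ℝ, 0 < ρ ∧ ρ < 1 ∧ 0 < C ∧
    ∀ n : ℕ, 1 ≤ n → ∀ u v : S, |nStep R n u v - π v| ≤ C * ρ ^ n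

/-- The σ-algebra generated by the first `n` drawn colours `Z 0, …, Z (n - 1)`. For an urn it
is the whole past at time `n`, since the configurations up to time `n` are functions of these
colours. -/
abbrev drawHistory {S Ω : Type*} [MeasurableSpace S] (Z : ℕ → Ω → S) (n : ℕ) : MeasurableSpace Ω :=
  ⨆ k : Fin n, MeasurableSpace.comap (Z k) inferInstance

/-- `U` (configurations) and `Z` (drawn colours, `Z n` being the colour of draw `n + 1`) form an
urn process with replacement matrix `R` and deterministic initial configuration `U₀`, of total
mass `t`: the drawn colour, given the past, has law `U n / (n + t)`, and then the row of `R` that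
belongs to the drawn colour is added to the configuration. -/
structure IsUrnProcess {S Ω : Type*} [MeasurableSpace S] [MeasurableSpace Ω] (P : Measure Ω)
    (R : Matrix S S ℝ) (U₀ : S → ℝ) (t : ℝ) (U : ℕ → Ω → S → ℝ) (Z : ℕ → Ω → S) : Prop where
  measurable_draw : ∀ n, Measurable (Z n)
  initial : ∀ ω, U 0 ω = U₀
  recursion : ∀ n ω v, U (n + 1) ω v = U n ω v + R (Z n ω) v
  draw_law : ∀ n z,
    P[(Z n ⁻¹' {z}).indicator (fun _ => (1 : ℝ)) | drawHistory Z n]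
      =ᵐ[P] fun ω => U n ω z / ((n : ℝ) + t)

/-- The number of times the colour `v` is drawn among `Z 0, …, Z n`. -/
noncomputable def drawCount {S Ω : Type*} (Z : ℕ → Ω → S) (n : ℕ) (v : S) (ω : Ω) : ℝ :=
  ∑ k ∈ Finset.range (n + 1), (Z k ⁻¹' {v}).indicator (fun _ => (1 : ℝ)) ω

/-- Convergence in `ℓ¹(S)`: the `ℓ¹`-distance, computed in `[0, ∞]`, tends to zero. -/
def TendstoL1 {S : Type*} (x : ℕ → S → ℝ) (y : S → ℝ) : Prop :=
  Tendsto (fun n => ∑' v, ENNReal.ofReal |x n v - y v|) atTop (𝓝 0)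

/-! Fix a colour `v`, put `h_k(u) = R^k(u, v)`, and let `A_k(n)` be the average of `h_k` over the
first `n` draws. Since `U n` is `U₀` plus the rows of the drawn colours, the conditional mean of
`h_k (Z n)` given the past is `A_{k+1}(n)` up to `O(1/n)` (`eventuallyWithin_step`). By the strong
law for bounded martingale differences, `A_k` is asymptotic to the Cesàro means of these predictions
(`ae_tendsto_average_sub`). Hence a bound `ε` on the asymptotic distance of `A_{k+1}` from `π v`
passes to `A_k` without loss. Uniform ergodicity supplies `ε = C ρ^(m+1)` at level `m + 1`.
Descending to level `0` and then letting `m → ∞` gives both coordinatewise limits: `A_0` is the draw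
frequency of `v`, and the prediction of `h_0` is `U n v / (n + t)`. Both sequences consist of
probability vectors, so Scheffé's argument upgrades the limits to `ℓ¹`. -/

/-! ### Asymptotic bounds and Cesàro means. -/

/-- All limit points of the real sequence `x` are within distance `ε` of `c`. -/
def EventuallyWithin (x : ℕ → ℝ) (c ε : ℝ) : Prop :=
  ∀ δ, ε < δ → ∀ᶠ n in atTop, |x n - c| ≤ δ

theorem EventuallyWithin.of_sub_tendsto_zero {x y : ℕ → ℝ} {c ε : ℝ}
    (hx : EventuallyWithin x c ε) (h : Tendsto (fun n => y n - x n) atTop (𝓝 0)) :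
    EventuallyWithin y c ε := by
  intro δ hδ
  have h2 := (Metric.tendsto_nhds.1 h) ((δ - ε) / 2) (by linarith)
  filter_upwards [hx ((ε + δ) / 2) (by linarith), h2] with n h3 h4
  rw [Real.dist_eq, sub_zero] at h4
  calc |y n - c| = |(y n - x n) + (x n - c)| := by ring_nf
    _ ≤ |y n - x n| + |x n - c| := abs_add_le _ _
    _ ≤ δ := by linarith

/-- Averaging does not enlarge `ε`, which lets the descent take arbitrarily many steps at no cost.
-/
theorem EventuallyWithin.cesaro {x : ℕ → ℝ} {c ε : ℝ}
    (hx : EventuallyWithin x c ε) :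
    EventuallyWithin (fun n : ℕ => (∑ j ∈ Finset.range n, x j) / n) c ε := by
  -- The excess of the distance over `ε` tends to zero, so ordinary Cesàro convergence applies to
  -- it.
  have h0 : Tendsto (fun n => max (|x n - c| - ε) 0) atTop (𝓝 0) := by
    rw [Metric.tendsto_nhds]
    intro δ hδ
    filter_upwards [hx (ε + δ / 2) (by linarith)] with n hn
    rw [Real.dist_eq, sub_zero, abs_of_nonneg (le_max_right _ _)]
    exact max_lt (by linarith) hδ
  intro δ hδ
  have h1 := (Metric.tendsto_nhds.1 h0.cesaro) (δ - ε) (by linarith)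
  filter_upwards [h1, eventually_gt_atTop 0] with n hn hpos
  have hn0 : (0 : ℝ) < n := by exact_mod_cast hpos
  rw [Real.dist_eq, sub_zero] at hn
  have h2 := (le_abs_self _).trans hn.le
  have h3 : (∑ j ∈ Finset.range n, x j) / n - c = (n : ℝ)⁻¹ * ∑ j ∈ Finset.range n, (x j - c) := by
    rw [Finset.sum_sub_distrib]
    simp
    field_simp
  have h4 : |∑ j ∈ Finset.range n, (x j - c)| ≤
      ∑ j ∈ Finset.range n, (ε + max (|x j - c| - ε) 0) := by
    refine (Finset.abs_sum_le_sum_abs _ _).trans (Finset.sum_le_sum fun j _ => ?_)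
    linarith [le_max_left (|x j - c| - ε) 0]
  rw [Finset.sum_add_distrib] at h4
  simp only [Finset.sum_const, Finset.card_range, nsmul_eq_mul] at h4
  rw [h3, abs_mul, abs_of_pos (inv_pos.2 hn0)]
  calc (n : ℝ)⁻¹ * |∑ j ∈ Finset.range n, (x j - c)|
      ≤ (n : ℝ)⁻¹ * (n * ε + ∑ j ∈ Finset.range n, max (|x j - c| - ε) 0) := by gcongr
    _ = ε + (n : ℝ)⁻¹ * ∑ j ∈ Finset.range n, max (|x j - c| - ε) 0 := by
        field_simp
    _ ≤ δ := by linarith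

theorem tendsto_of_eventuallyWithin {x : ℕ → ℝ} {c : ℝ} {ε : ℕ → ℝ}
    (hε : Tendsto ε atTop (𝓝 0)) (h : ∀ m, EventuallyWithin x c (ε m)) :
    Tendsto x atTop (𝓝 c) := by
  rw [Metric.tendsto_nhds]
  intro δ hδ
  obtain ⟨m, hm⟩ := (hε.eventually_lt_const (half_pos hδ)).exists
  filter_upwards [h m (δ / 2) hm] with n hn
  rw [Real.dist_eq]
  linarith

/-! ### From coordinatewise to `ℓ¹` convergence. -/

/-- Scheffé: equal total masses make the `ℓ¹` distance twice the sum of the positive parts of `y - x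
n`, and these are dominated by the summable `y`. -/
theorem tendstoL1_of_tendsto {S : Type*} {x : ℕ → S → ℝ} {y : S → ℝ}
    (hx : ∀ n v, 0 ≤ x n v) (hx1 : ∀ n, HasSum (x n) 1) (hy : ∀ v, 0 ≤ y v) (hy1 : HasSum y 1)
    (h : ∀ v, Tendsto (fun n => x n v) atTop (𝓝 (y v))) : TendstoL1 x y := by
  have hp : Tendsto (fun n => ∑' v, max (y v - x n v) 0) atTop (𝓝 (∑' _ : S, (0 : ℝ))) := by
    refine tendsto_tsum_of_dominated_convergence (bound := y) hy1.summable (fun v => ?_) ?_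
    · have := ((h v).const_sub (y v)).max (tendsto_const_nhds (x := (0 : ℝ)))
      simpa using this
    · refine Eventually.of_forall fun n v => ?_
      rw [Real.norm_eq_abs, abs_of_nonneg (le_max_right _ _)]
      exact max_le (by linarith [hx n v]) (hy v)
  rw [tsum_zero] at hp
  have hs : ∀ n, Summable fun v => max (y v - x n v) 0 := fun n =>
    hy1.summable.of_nonneg_of_le (fun v => le_max_right _ _)
      (fun v => max_le (by linarith [hx n v]) (hy v))
  have habs : ∀ n, HasSum (fun v => |x n v - y v|) (2 * ∑' v, max (y v - x n v) 0) := by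
    intro n
    have := ((hx1 n).sub hy1).add ((hs n).hasSum.mul_left 2)
    rw [sub_self, zero_add] at this
    suffices hv : (fun v => |x n v - y v|) = fun v => x n v - y v + 2 * max (y v - x n v) 0 by
      rw [hv]; exact this
    funext v
    rcases le_total (y v) (x n v) with h | h
    · rw [max_eq_right (by linarith), abs_of_nonneg (by linarith)]; ring
    · rw [max_eq_left (by linarith), abs_of_nonpos (by linarith)]; ring
  have key : ∀ n, ∑' v, ENNReal.ofReal |x n v - y v| =
      ENNReal.ofReal (2 * ∑' v, max (y v - x n v) 0) := fun n => by
    rw [← ENNReal.ofReal_tsum_of_nonneg (fun v => abs_nonneg _) (habs n).summable,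
      (habs n).tsum_eq]
  unfold TendstoL1
  simp_rw [key]
  simpa using ENNReal.tendsto_ofReal (hp.const_mul 2)

/-! ### Strong law for bounded martingale differences. -/

/-- Between consecutive squares `m` moves by at most `2 √n`, which is negligible against `n`. -/
theorem tendsto_div_of_tendsto_sq {m : ℕ → ℝ} (hm : ∀ n, |m (n + 1) - m n| ≤ 1)
    (h : Tendsto (fun q : ℕ => m (q * q) / ((q : ℝ) * q)) atTop (𝓝 0)) :
    Tendsto (fun n : ℕ => m n / n) atTop (𝓝 0) := by
  have hinc : ∀ a k, |m (a + k) - m a| ≤ k := by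
    intro a k
    induction k with
    | zero => simp
    | succ k ih =>
      have := abs_sub_le (m (a + (k + 1))) (m (a + k)) (m a)
      push_cast
      rw [← add_assoc] at this ⊢
      linarith [hm (a + k)]
  have hsqrt : Tendsto Nat.sqrt atTop atTop := by
    refine tendsto_atTop.2 fun b => ?_
    filter_upwards [eventually_ge_atTop (b * b)] with n hn
    exact Nat.le_sqrt.2 hn
  have hlim : Tendsto (fun n : ℕ => |m (n.sqrt * n.sqrt) / ((n.sqrt : ℝ) * n.sqrt)| +
      2 * (n.sqrt : ℝ)⁻¹) atTop (𝓝 0) := by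
    have h1 := ((h.comp hsqrt).abs).add
      (((tendsto_inv_atTop_nhds_zero_nat (𝕜 := ℝ)).comp hsqrt).const_mul 2)
    simpa [Function.comp_def] using h1
  refine squeeze_zero_norm' ?_ hlim
  filter_upwards [eventually_ge_atTop 1] with n hn
  have hq : 1 ≤ n.sqrt := Nat.le_sqrt.2 (by simpa using hn)
  have hle : n.sqrt * n.sqrt ≤ n := Nat.sqrt_le n
  have hge : n ≤ n.sqrt * n.sqrt + n.sqrt + n.sqrt := Nat.sqrt_le_add n
  generalize n.sqrt = q at *
  obtain ⟨k, rfl⟩ := Nat.exists_eq_add_of_le hle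
  have hq0 : (0 : ℝ) < q := by exact_mod_cast hq
  have hk : (k : ℝ) ≤ 2 * q := by
    have : k ≤ 2 * q := by omega
    exact_mod_cast this
  have h1 := hinc (q * q) k
  have h2 : |m (q * q + k)| ≤ |m (q * q)| + 2 * q := by
    have := abs_sub_abs_le_abs_sub (m (q * q + k)) (m (q * q))
    linarith
  rw [Real.norm_eq_abs, abs_div, abs_div, abs_of_pos (mul_pos hq0 hq0), Nat.abs_cast]
  have hle' : (q : ℝ) * q ≤ ((q * q + k : ℕ) : ℝ) := by exact_mod_cast hle
  calc |m (q * q + k)| / ((q * q + k : ℕ) : ℝ) ≤ (|m (q * q)| + 2 * q) / ((q : ℝ) * q) := by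
        gcongr
    _ = _ := by field_simp

/-- The strong law of large numbers for martingale differences bounded by `1`. -/
theorem ae_tendsto_sum_div_of_condExp_eq_zero {Ω : Type*} {m0 : MeasurableSpace Ω} (P : Measure Ω)
    [IsProbabilityMeasure P] (ℱ : Filtration ℕ m0) (D : ℕ → Ω → ℝ)
    (hD : ∀ n, StronglyMeasurable[ℱ (n + 1)] (D n)) (hb : ∀ n ω, |D n ω| ≤ 1)
    (hc : ∀ n, P[D n | ℱ n] =ᵐ[P] 0) :
    ∀ᵐ ω ∂P, Tendsto (fun n : ℕ => (∑ j ∈ Finset.range n, D j ω) / n) atTop (𝓝 0) := by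
  set M : ℕ → Ω → ℝ := fun n ω => ∑ j ∈ Finset.range n, D j ω with hM
  have hMm : ∀ n, StronglyMeasurable[ℱ n] (M n) := fun n =>
    Finset.stronglyMeasurable_fun_sum _ fun j hj =>
      (hD j).mono (ℱ.mono (Finset.mem_range.1 hj))
  have hMb : ∀ n ω, |M n ω| ≤ n := fun n ω => by
    refine (Finset.abs_sum_le_sum_abs _ _).trans ?_
    refine (Finset.sum_le_sum fun j _ => hb j ω).trans ?_
    simp
  have hint : ∀ (f : Ω → ℝ) (C : ℝ), Measurable f → (∀ ω, |f ω| ≤ C) → Integrable f P :=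
    fun f C hf hC => Integrable.of_bound hf.aestronglyMeasurable C
      (Eventually.of_forall fun ω => hC ω)
  have hDm : ∀ n, Measurable (D n) := fun n => ((hD n).mono (ℱ.le _)).measurable
  have hMm' : ∀ n, Measurable (M n) := fun n => ((hMm n).mono (ℱ.le _)).measurable
  have hMDi : ∀ n, Integrable (fun ω => M n ω * D n ω) P := fun n =>
    hint _ n ((hMm' n).mul (hDm n)) fun ω => by
      rw [abs_mul]
      exact (mul_le_mul (hMb n ω) (hb n ω) (abs_nonneg _) (Nat.cast_nonneg _)).trans (by simp)
  have hDi : ∀ n, Integrable (D n) P := fun n => hint _ 1 (hDm n) (hb n)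
  have hM2i : ∀ n, Integrable (fun ω => M n ω ^ 2) P := fun n =>
    hint _ ((n : ℝ) ^ 2) ((hMm' n).pow_const 2) fun ω => by
      rw [abs_pow]
      exact pow_le_pow_left₀ (abs_nonneg _) (hMb n ω) 2
  -- Orthogonality of the increments; it makes the second moment of `M n` grow at most linearly.
  have hMD : ∀ n, ∫ ω, M n ω * D n ω ∂P = 0 := by
    intro n
    have h1 : P[fun ω => M n ω * D n ω | ℱ n] =ᵐ[P] fun ω => M n ω * (P[D n | ℱ n]) ω :=
      condExp_mul_of_stronglyMeasurable_left (hMm n) (hMDi n) (hDi n)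
    rw [← integral_condExp (ℱ.le n)]
    rw [integral_congr_ae (g := fun _ => (0 : ℝ)), integral_zero]
    filter_upwards [h1, hc n] with ω h2 h3
    rw [h2, h3]; simp
  have hsq : ∀ n, ∫ ω, M n ω ^ 2 ∂P ≤ n := by
    intro n
    induction n with
    | zero => simp [hM]
    | succ n ih =>
      have h21 : Integrable (fun ω => 2 * (M n ω * D n ω) + 1) P :=
        ((hMDi n).const_mul 2).add (integrable_const 1)
      have hle : ∫ ω, M (n + 1) ω ^ 2 ∂P ≤ ∫ ω, (M n ω ^ 2 + (2 * (M n ω * D n ω) + 1)) ∂P := by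
        refine integral_mono (hM2i _) ((hM2i n).add h21) fun ω => ?_
        have h1 : M (n + 1) ω = M n ω + D n ω := Finset.sum_range_succ _ _
        have h2 : D n ω ^ 2 ≤ 1 := by
          rw [← sq_abs]
          exact pow_le_one₀ (abs_nonneg _) (hb n ω)
        simp only [h1]
        linarith [add_sq (M n ω) (D n ω)]
      rw [integral_add (hM2i n) h21,
        integral_add ((hMDi n).const_mul 2) (integrable_const 1), integral_const_mul, hMD n] at hle
      simp at hle
      push_cast
      linarith
  -- Along squares the second moments are at most `1 / q ^ 2`, hence summable; so `∑ Q q` is almost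
  -- surely finite and its terms tend to zero.
  set Q : ℕ → Ω → ℝ := fun q ω => (M (q * q) ω / ((q : ℝ) * q)) ^ 2 with hQ
  have hQi : ∀ q, Integrable (Q q) P := fun q => by
    have := (hM2i (q * q)).div_const (((q : ℝ) * q) ^ 2)
    simpa only [hQ, div_pow] using this
  have hQle : ∀ q, ∫ ω, Q q ω ∂P ≤ 1 / (q : ℝ) ^ 2 := by
    intro q
    simp only [hQ, div_pow]
    rw [integral_div]
    rcases Nat.eq_zero_or_pos q with rfl | hq
    · simp
    have hq0 : (0 : ℝ) < q := by exact_mod_cast hq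
    have := hsq (q * q)
    push_cast at this
    calc _ ≤ ((q : ℝ) * q) / ((q : ℝ) * q) ^ 2 := by gcongr
      _ = _ := by field_simp
  have hsum : Summable fun q => ∫ ω, ‖Q q ω‖ ∂P := by
    refine (Real.summable_one_div_nat_pow.2 one_lt_two).of_nonneg_of_le
      (fun q => integral_nonneg fun ω => norm_nonneg _) fun q => ?_
    refine le_trans (le_of_eq ?_) (hQle q)
    exact integral_congr_ae (Eventually.of_forall fun ω =>
      by simp only [hQ, Real.norm_eq_abs, abs_sq])
  have hfin : ∑' q, ∫⁻ ω, ‖Q q ω‖ₑ ∂P ≠ ⊤ := by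
    have : ∀ q, ∫⁻ ω, ‖Q q ω‖ₑ ∂P = ENNReal.ofReal (∫ ω, ‖Q q ω‖ ∂P) := fun q =>
      (ofReal_integral_norm_eq_lintegral_enorm (hQi q)).symm
    simp_rw [this]
    exact hsum.tsum_ofReal_ne_top
  rw [← lintegral_tsum fun q => (hQi q).1.enorm] at hfin
  have hae := ae_lt_top' (AEMeasurable.tsum fun q => (hQi q).1.enorm) hfin
  filter_upwards [hae] with ω hω
  refine tendsto_div_of_tendsto_sq (m := fun n => M n ω) (fun n => ?_) ?_
  · simp only [hM, Finset.sum_range_succ, add_sub_cancel_left]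
    exact hb n ω
  · have h1 : Tendsto (fun q => ‖Q q ω‖ₑ) atTop (𝓝 0) :=
      ENNReal.tendsto_atTop_zero_of_tsum_ne_top hω.ne
    have h2 : Tendsto (fun q => ‖Q q ω‖) atTop (𝓝 0) := by
      have := (ENNReal.tendsto_toReal ENNReal.zero_ne_top).comp h1
      simpa [Function.comp_def] using this
    have h3 := h2.sqrt
    simp only [hQ, Real.norm_eq_abs, abs_sq, Real.sqrt_sq_eq_abs,
      Real.sqrt_zero] at h3
    exact (tendsto_zero_iff_abs_tendsto_zero _).2 h3

/-! ### Matrix powers and the urn's deterministic identities. -/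

theorem nStep_mem_Icc {S : Type*} {R : Matrix S S ℝ} (hR : IsStochasticMatrix R) (k : ℕ)
    (u v : S) : nStep R k u v ∈ Set.Icc (0 : ℝ) 1 := by
  induction k generalizing u with
  | zero => simp only [nStep]; split_ifs <;> simp
  | succ k ih =>
    rw [nStep]
    have h0 : ∀ w, 0 ≤ R u w * nStep R k w v := fun w => mul_nonneg (hR.nonneg u w) (ih w).1
    have h1 : ∀ w, R u w * nStep R k w v ≤ R u w := fun w =>
      mul_le_of_le_one_right (hR.nonneg u w) (ih w).2
    refine ⟨tsum_nonneg h0, ?_⟩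
    rw [← (hR.hasSum_row u).tsum_eq]
    exact Summable.tsum_le_tsum h1 ((hR.hasSum_row u).summable.of_nonneg_of_le h0 h1)
      (hR.hasSum_row u).summable

theorem HasSum.summable_mul_of_mem_Icc {S : Type*} {a : S → ℝ} {s : ℝ} (ha : HasSum a s) (ha0 : ∀ v, 0 ≤ a v)
    {h : S → ℝ} (hh : ∀ v, h v ∈ Set.Icc (0 : ℝ) 1) : Summable fun v => a v * h v :=
  ha.summable.of_nonneg_of_le (fun v => mul_nonneg (ha0 v) (hh v).1)
    fun v => mul_le_of_le_one_right (ha0 v) (hh v).2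

theorem measurable_draw_drawHistory {S Ω : Type*} [MeasurableSpace S] {Z : ℕ → Ω → S} {j n : ℕ} (hj : j < n) :
    Measurable[drawHistory Z n] (Z j) := by
  rw [measurable_iff_comap_le]
  exact le_iSup (fun k : Fin n => MeasurableSpace.comap (Z k) inferInstance) ⟨j, hj⟩

section Urn

variable {S Ω : Type*} [MeasurableSpace S] [MeasurableSpace Ω] {P : Measure Ω}
  {R : Matrix S S ℝ} {U₀ : S → ℝ} {t : ℝ} {U : ℕ → Ω → S → ℝ} {Z : ℕ → Ω → S}

theorem IsUrnProcess.nonneg (hUrn : IsUrnProcess P R U₀ t U Z) (hR : IsStochasticMatrix R)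
    (hU₀ : ∀ v, 0 ≤ U₀ v) (n : ℕ) (ω : Ω) (v : S) : 0 ≤ U n ω v := by
  induction n with
  | zero => rw [hUrn.initial]; exact hU₀ v
  | succ n ih => rw [hUrn.recursion]; exact add_nonneg ih (hR.nonneg _ _)

theorem IsUrnProcess.eq_sum (hUrn : IsUrnProcess P R U₀ t U Z) (n : ℕ) (ω : Ω) (v : S) :
    U n ω v = U₀ v + ∑ j ∈ Finset.range n, R (Z j ω) v := by
  induction n with
  | zero => simp [hUrn.initial]
  | succ n ih => rw [hUrn.recursion, ih, Finset.sum_range_succ, add_assoc]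

theorem IsUrnProcess.hasSum (hUrn : IsUrnProcess P R U₀ t U Z) (hR : IsStochasticMatrix R)
    (hU₀t : HasSum U₀ t) (n : ℕ) (ω : Ω) : HasSum (U n ω) ((n : ℝ) + t) := by
  have h := hU₀t.add (hasSum_sum (s := Finset.range n) fun j _ => hR.hasSum_row (Z j ω))
  have h2 : U n ω = fun v => U₀ v + ∑ j ∈ Finset.range n, R (Z j ω) v :=
    funext fun v => hUrn.eq_sum n ω v
  rw [h2]
  simpa [add_comm] using h

/-- Integrating `h` against the configuration turns each draw into a value of `R h`: this raises the
level from `k` to `k + 1`. -/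
theorem IsUrnProcess.hasSum_mul (hUrn : IsUrnProcess P R U₀ t U Z) (hR : IsStochasticMatrix R)
    (hU₀ : ∀ v, 0 ≤ U₀ v) (hU₀t : HasSum U₀ t) {h : S → ℝ} (hh : ∀ v, h v ∈ Set.Icc (0 : ℝ) 1)
    (n : ℕ) (ω : Ω) : HasSum (fun v => U n ω v * h v)
      (∑' v, U₀ v * h v + ∑ j ∈ Finset.range n, ∑' v, R (Z j ω) v * h v) := by
  have h1 := (hU₀t.summable_mul_of_mem_Icc hU₀ hh).hasSum.add
    (hasSum_sum (s := Finset.range n) fun j _ =>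
      ((hR.hasSum_row (Z j ω)).summable_mul_of_mem_Icc (hR.nonneg _) hh).hasSum)
  simpa only [hUrn.eq_sum, add_mul, Finset.sum_mul] using h1

theorem IsUrnProcess.drawHistory_le (hUrn : IsUrnProcess P R U₀ t U Z) (n : ℕ) :
    drawHistory Z n ≤ ‹MeasurableSpace Ω› :=
  iSup_le fun k => (hUrn.measurable_draw k).comap_le

/-- The filtration generated by the drawn colours. -/
def IsUrnProcess.filtration (hUrn : IsUrnProcess P R U₀ t U Z) :
    Filtration ℕ ‹MeasurableSpace Ω› where
  seq := drawHistory Z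
  mono' _ _ hnm := iSup_le fun k =>
    measurable_iff_comap_le.1 (measurable_draw_drawHistory (k.2.trans_le hnm))
  le' := hUrn.drawHistory_le

theorem IsUrnProcess.prediction_mem_Icc (hUrn : IsUrnProcess P R U₀ t U Z)
    (hR : IsStochasticMatrix R) (hU₀ : ∀ v, 0 ≤ U₀ v) (ht : 0 < t) (hU₀t : HasSum U₀ t)
    {h : S → ℝ} (hh : ∀ v, h v ∈ Set.Icc (0 : ℝ) 1) (n : ℕ) (ω : Ω) :
    (∑' v, U n ω v * h v) / ((n : ℝ) + t) ∈ Set.Icc (0 : ℝ) 1 := by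
  have hnt : 0 < (n : ℝ) + t := by positivity
  have hU0 := hUrn.nonneg hR hU₀ n ω
  have hsum := hUrn.hasSum hR hU₀t n ω
  refine ⟨div_nonneg (tsum_nonneg fun v => mul_nonneg (hU0 v) (hh v).1) hnt.le, ?_⟩
  rw [div_le_one hnt, ← hsum.tsum_eq]
  exact Summable.tsum_le_tsum (fun v => mul_le_of_le_one_right (hU0 v) (hh v).2)
    (hsum.summable_mul_of_mem_Icc hU0 hh) hsum.summable

/-- One step of the backward comparison: asymptotic bounds for the averages of `R h` are
inherited by the averages of `h` and by the predictions. -/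
theorem IsUrnProcess.eventuallyWithin_step (hUrn : IsUrnProcess P R U₀ t U Z)
    (hR : IsStochasticMatrix R) (hU₀ : ∀ v, 0 ≤ U₀ v) (ht : 0 < t) (hU₀t : HasSum U₀ t)
    {h g : S → ℝ} (hh : ∀ v, h v ∈ Set.Icc (0 : ℝ) 1) (hg : ∀ v, g v ∈ Set.Icc (0 : ℝ) 1)
    (hgh : ∀ u, g u = ∑' v, R u v * h v) (ω : Ω) {c ε : ℝ}
    (hc : EventuallyWithin (fun n : ℕ => (∑ j ∈ Finset.range n, g (Z j ω)) / n) c ε) :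
    EventuallyWithin (fun n : ℕ => (∑' v, U n ω v * h v) / ((n : ℝ) + t)) c ε := by
  refine hc.of_sub_tendsto_zero ?_
  set c₀ := ∑' v, U₀ v * h v
  have hlim : Tendsto (fun n : ℕ => (|c₀| + t) / (n : ℝ)) atTop (𝓝 0) :=
    tendsto_const_div_atTop_nhds_zero_nat _
  refine squeeze_zero_norm' ?_ hlim
  filter_upwards [eventually_gt_atTop 0] with n hn
  have hn0 : (0 : ℝ) < n := by exact_mod_cast hn
  rw [(hUrn.hasSum_mul hR hU₀ hU₀t hh n ω).tsum_eq]
  simp_rw [← hgh]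
  have hG0 : 0 ≤ ∑ j ∈ Finset.range n, g (Z j ω) := Finset.sum_nonneg fun j _ => (hg _).1
  have hG1 : ∑ j ∈ Finset.range n, g (Z j ω) ≤ n :=
    (Finset.sum_le_sum fun j _ => (hg _).2).trans (by simp)
  set G := ∑ j ∈ Finset.range n, g (Z j ω)
  have h1 : (c₀ + G) / ((n : ℝ) + t) - G / n = (c₀ - t * (G / n)) / ((n : ℝ) + t) := by
    field_simp
    ring
  have h2 : |t * (G / n)| ≤ t := by
    rw [abs_of_nonneg (by positivity)]
    exact mul_le_of_le_one_right ht.le ((div_le_one hn0).2 hG1)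
  rw [h1, Real.norm_eq_abs, abs_div, abs_of_pos (by positivity : 0 < (n : ℝ) + t)]
  have h3 := abs_sub c₀ (t * (G / n))
  gcongr
  · linarith
  · linarith

/-! ### Conditional law of the draws. -/

variable [DiscreteMeasurableSpace S]

theorem IsUrnProcess.stronglyMeasurable_apply (hUrn : IsUrnProcess P R U₀ t U Z) (n : ℕ) (v : S) :
    StronglyMeasurable[drawHistory Z n] fun ω => U n ω v := by
  simp_rw [hUrn.eq_sum]
  refine Measurable.stronglyMeasurable (measurable_const.add ?_)
  exact Finset.measurable_fun_sum _ fun j hj =>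
    (Measurable.of_discrete (f := fun z => R z v)).comp
      (measurable_draw_drawHistory (Finset.mem_range.1 hj))

theorem IsUrnProcess.stronglyMeasurable_prediction (hUrn : IsUrnProcess P R U₀ t U Z)
    (hR : IsStochasticMatrix R) (hU₀ : ∀ v, 0 ≤ U₀ v) (hU₀t : HasSum U₀ t)
    {h : S → ℝ} (hh : ∀ v, h v ∈ Set.Icc (0 : ℝ) 1) (n : ℕ) :
    StronglyMeasurable[drawHistory Z n] fun ω => (∑' v, U n ω v * h v) / ((n : ℝ) + t) := by
  simp_rw [(hUrn.hasSum_mul hR hU₀ hU₀t hh n _).tsum_eq]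
  refine Measurable.stronglyMeasurable (Measurable.div_const (measurable_const.add ?_) _)
  exact Finset.measurable_fun_sum _ fun j hj =>
    (Measurable.of_discrete (f := fun z => ∑' v, R z v * h v)).comp
      (measurable_draw_drawHistory (Finset.mem_range.1 hj))

/-- The draw law concerns single colours; it extends to `h` by linearity on finite sets of colours
and dominated convergence, all partial sums lying in `[0, 1]`. -/
theorem IsUrnProcess.condExp_draw [Countable S] [IsProbabilityMeasure P]
    (hUrn : IsUrnProcess P R U₀ t U Z) (hR : IsStochasticMatrix R)
    (hU₀ : ∀ v, 0 ≤ U₀ v) (ht : 0 < t) (hU₀t : HasSum U₀ t)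
    {h : S → ℝ} (hh : ∀ v, h v ∈ Set.Icc (0 : ℝ) 1) (n : ℕ) :
    P[fun ω => h (Z n ω) | drawHistory Z n] =ᵐ[P] fun ω =>
      (∑' v, U n ω v * h v) / ((n : ℝ) + t) := by
  classical
  have hnt : 0 < (n : ℝ) + t := by positivity
  have hU0 := hUrn.nonneg hR hU₀ n
  have hsm : ∀ ω, Summable fun v => U n ω v * h v := fun ω =>
    (hUrn.hasSum hR hU₀t n ω).summable_mul_of_mem_Icc (hU0 ω) hh
  -- Countability of `S` provides a sequence of finite sets exhausting it.
  obtain ⟨s, hs⟩ := exists_seq_tendsto (atTop : Filter (Finset S))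
  set F : S → Ω → ℝ := fun v => h v • (Z n ⁻¹' {v}).indicator (fun _ => (1 : ℝ)) with hF
  set G : S → Ω → ℝ := fun v ω => U n ω v * h v / ((n : ℝ) + t) with hG
  have hFω : ∀ v ω, F v ω = if v = Z n ω then h v else 0 := fun v ω => by
    simp [hF, Set.indicator_apply, eq_comm]
  have hFs : ∀ ω, HasSum (fun v => F v ω) (h (Z n ω)) := fun ω => by
    have h1 := hasSum_single (f := fun v => F v ω) (Z n ω) fun v hv => by simp [hFω, hv]
    simpa only [hFω, if_true] using h1
  have hGs : ∀ ω, HasSum (fun v => G v ω) ((∑' v, U n ω v * h v) / ((n : ℝ) + t)) := fun ω =>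
    (hsm ω).hasSum.div_const _
  have hF0 : ∀ v ω, 0 ≤ F v ω := fun v ω => by
    rw [hFω]; split_ifs <;> simp [(hh v).1]
  have hG0 : ∀ v ω, 0 ≤ G v ω := fun v ω =>
    div_nonneg (mul_nonneg (hU0 ω v) (hh v).1) hnt.le
  have hG1 : ∀ ω, (∑' v, U n ω v * h v) / ((n : ℝ) + t) ≤ 1 := fun ω =>
    (hUrn.prediction_mem_Icc hR hU₀ ht hU₀t hh n ω).2
  have hFb : ∀ (A : Finset S) ω, ‖∑ v ∈ A, F v ω‖ ≤ 1 := fun A ω => by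
    rw [Real.norm_of_nonneg (Finset.sum_nonneg fun v _ => hF0 v ω)]
    exact (sum_le_hasSum A (fun v _ => hF0 v ω) (hFs ω)).trans (hh _).2
  have hGb : ∀ (A : Finset S) ω, ‖∑ v ∈ A, G v ω‖ ≤ 1 := fun A ω => by
    rw [Real.norm_of_nonneg (Finset.sum_nonneg fun v _ => hG0 v ω)]
    exact (sum_le_hasSum A (fun v _ => hG0 v ω) (hGs ω)).trans (hG1 ω)
  have hGm : ∀ v, StronglyMeasurable[drawHistory Z n] (G v) := fun v =>
    ((hUrn.stronglyMeasurable_apply n v).measurable.mul_const _ |>.div_const _).stronglyMeasurable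
  have hGm' : ∀ v, StronglyMeasurable (G v) := fun v => (hGm v).mono (hUrn.drawHistory_le n)
  have hIm : ∀ v, Integrable ((Z n ⁻¹' {v}).indicator (fun _ => (1 : ℝ))) P := fun v =>
    (integrable_const 1).indicator (hUrn.measurable_draw n (measurableSet_singleton v))
  have hFi : ∀ v, Integrable (F v) P := fun v => (hIm v).smul _
  have hGi : ∀ v, Integrable (G v) P := fun v =>
    Integrable.of_bound (hGm' v).aestronglyMeasurable 1
      (Eventually.of_forall fun ω => by simpa using hGb {v} ω)
  have hFG : ∀ v, P[F v | drawHistory Z n] =ᵐ[P] P[G v | drawHistory Z n] := fun v => by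
    rw [condExp_of_stronglyMeasurable (hUrn.drawHistory_le n) (hGm v) (hGi v)]
    filter_upwards [condExp_smul (μ := P) (h v) ((Z n ⁻¹' {v}).indicator (fun _ => (1 : ℝ)))
      (drawHistory Z n), hUrn.draw_law n v] with ω h1 h2
    rw [h1, Pi.smul_apply, h2, smul_eq_mul]
    simp only [hG]
    ring
  have key := tendsto_condExp_unique (m := drawHistory Z n) (μ := P)
    (fun k => ∑ v ∈ s k, F v) (fun k => ∑ v ∈ s k, G v)
    (fun ω => h (Z n ω)) (fun ω => (∑' v, U n ω v * h v) / ((n : ℝ) + t))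
    (fun k => integrable_finsetSum' _ fun v _ => hFi v)
    (fun k => integrable_finsetSum' _ fun v _ => hGi v)
    (Eventually.of_forall fun ω => by
      simp only [Finset.sum_apply]; exact (hFs ω).comp hs)
    (Eventually.of_forall fun ω => by
      simp only [Finset.sum_apply]; exact (hGs ω).comp hs)
    (fun _ => 1) (integrable_const 1) (fun _ => 1) (integrable_const 1)
    (fun k => Eventually.of_forall fun ω => by simpa only [Finset.sum_apply] using hFb (s k) ω)
    (fun k => Eventually.of_forall fun ω => by simpa only [Finset.sum_apply] using hGb (s k) ω)
    (fun k => by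
      refine (condExp_finsetSum (fun v _ => hFi v) _).trans
        (EventuallyEq.trans ?_ (condExp_finsetSum (fun v _ => hGi v) _).symm)
      have hall := ae_all_iff.2 hFG
      filter_upwards [hall] with ω hω
      simp only [Finset.sum_apply]
      exact Finset.sum_congr rfl fun v _ => hω v)
  refine key.trans ?_
  have hlim := hUrn.stronglyMeasurable_prediction hR hU₀ hU₀t hh n
  rw [condExp_of_stronglyMeasurable (hUrn.drawHistory_le n) hlim]
  refine Integrable.of_bound (hlim.mono (hUrn.drawHistory_le n)).aestronglyMeasurable 1
    (Eventually.of_forall fun ω => ?_)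
  rw [Real.norm_of_nonneg ((hGs ω).nonneg fun v => hG0 v ω)]
  exact hG1 ω

/-- The average of `h` over the drawn colours is asymptotic to the average of its predictions. -/
theorem IsUrnProcess.ae_tendsto_average_sub [Countable S] [IsProbabilityMeasure P]
    (hUrn : IsUrnProcess P R U₀ t U Z) (hR : IsStochasticMatrix R)
    (hU₀ : ∀ v, 0 ≤ U₀ v) (ht : 0 < t) (hU₀t : HasSum U₀ t)
    {h : S → ℝ} (hh : ∀ v, h v ∈ Set.Icc (0 : ℝ) 1) :
    ∀ᵐ ω ∂P, Tendsto (fun n : ℕ => (∑ j ∈ Finset.range n, h (Z j ω)) / n -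
      (∑ j ∈ Finset.range n, (∑' v, U j ω v * h v) / ((j : ℝ) + t)) / n) atTop (𝓝 0) := by
  set Y : ℕ → Ω → ℝ := fun n ω => (∑' v, U n ω v * h v) / ((n : ℝ) + t) with hY
  have hX : ∀ n, StronglyMeasurable[hUrn.filtration (n + 1)] fun ω => h (Z n ω) := fun n =>
    ((Measurable.of_discrete (f := h)).comp
      (measurable_draw_drawHistory n.lt_succ_self)).stronglyMeasurable
  have hYm : ∀ n, StronglyMeasurable[hUrn.filtration n] (Y n) :=
    hUrn.stronglyMeasurable_prediction hR hU₀ hU₀t hh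
  have hYI := hUrn.prediction_mem_Icc hR hU₀ ht hU₀t hh
  have hXi : ∀ n, Integrable (fun ω => h (Z n ω)) P := fun n =>
    Integrable.of_bound ((hX n).mono (hUrn.filtration.le _)).aestronglyMeasurable 1
      (Eventually.of_forall fun ω => by rw [Real.norm_of_nonneg (hh _).1]; exact (hh _).2)
  have hYi : ∀ n, Integrable (Y n) P := fun n =>
    Integrable.of_bound ((hYm n).mono (hUrn.filtration.le _)).aestronglyMeasurable 1
      (Eventually.of_forall fun ω => by rw [Real.norm_of_nonneg (hYI n ω).1]; exact (hYI n ω).2)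
  have key := ae_tendsto_sum_div_of_condExp_eq_zero P hUrn.filtration
    (fun n => (fun ω => h (Z n ω)) - Y n)
    (fun n => (hX n).sub ((hYm n).mono (hUrn.filtration.mono n.le_succ)))
    (fun n ω => abs_sub_le_of_le_of_le (hh _).1 (hh _).2 (hYI n ω).1 (hYI n ω).2 |>.trans
      (by simp))
    (fun n => by
      have h1 : P[Y n | hUrn.filtration n] = Y n :=
        condExp_of_stronglyMeasurable (hUrn.filtration.le n) (hYm n) (hYi n)
      filter_upwards [condExp_sub (hXi n) (hYi n) (hUrn.filtration n),
        hUrn.condExp_draw hR hU₀ ht hU₀t hh n] with ω h2 h3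
      rw [h2, Pi.sub_apply, h1, Pi.zero_apply, sub_eq_zero]
      exact h3)
  filter_upwards [key] with ω hω
  refine hω.congr fun n => ?_
  simp only [Pi.sub_apply, Finset.sum_sub_distrib, sub_div, hY]

/-! ### Descent through the powers of `R`. -/

theorem IsUrnProcess.ae_tendsto [Countable S] [IsProbabilityMeasure P]
    (hUrn : IsUrnProcess P R U₀ t U Z) (hR : IsStochasticMatrix R)
    (hU₀ : ∀ v, 0 ≤ U₀ v) (ht : 0 < t) (hU₀t : HasSum U₀ t) {π : S → ℝ}
    (herg : IsUniformlyErgodic R π) :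
    ∀ᵐ ω ∂P, ∀ v, Tendsto (fun n : ℕ => U n ω v / ((n : ℝ) + t)) atTop (𝓝 (π v)) ∧
      Tendsto (fun n : ℕ => drawCount Z n v ω / ((n : ℝ) + 1)) atTop (𝓝 (π v)) := by
  classical
  obtain ⟨ρ, C, hρ0, hρ1, hC, hbound⟩ := herg
  have hI : ∀ k v u, nStep R k u v ∈ Set.Icc (0 : ℝ) 1 := fun k v u => nStep_mem_Icc hR k u v
  have hstep : ∀ k v u, nStep R (k + 1) u v = ∑' w, R u w * nStep R k w v := fun _ _ _ => rfl
  -- One null set serves all of the countably many pairs `(v, k)`; the rest is pathwise.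
  have hall : ∀ᵐ ω ∂P, ∀ v k, Tendsto (fun n : ℕ =>
      (∑ j ∈ Finset.range n, nStep R k (Z j ω) v) / n -
      (∑ j ∈ Finset.range n, (∑' w, U j ω w * nStep R k w v) / ((j : ℝ) + t)) / n)
      atTop (𝓝 0) := by
    rw [ae_all_iff]; intro v
    rw [ae_all_iff]; intro k
    exact hUrn.ae_tendsto_average_sub hR hU₀ ht hU₀t (h := fun u => nStep R k u v) (hI k v)
  filter_upwards [hall] with ω hω v
  have hpred : ∀ k ε, EventuallyWithin (fun n : ℕ =>
      (∑ j ∈ Finset.range n, nStep R (k + 1) (Z j ω) v) / n) (π v) ε →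
      EventuallyWithin (fun n : ℕ => (∑' w, U n ω w * nStep R k w v) / ((n : ℝ) + t)) (π v) ε :=
    fun k ε h => hUrn.eventuallyWithin_step hR hU₀ ht hU₀t (h := fun u => nStep R k u v)
      (g := fun u => nStep R (k + 1) u v) (hI k v) (hI (k + 1) v)
      (hstep k v) ω h
  have hback : ∀ k ε, EventuallyWithin (fun n : ℕ =>
      (∑ j ∈ Finset.range n, nStep R (k + 1) (Z j ω) v) / n) (π v) ε →
      EventuallyWithin (fun n : ℕ => (∑ j ∈ Finset.range n, nStep R k (Z j ω) v) / n) (π v) ε :=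
    fun k ε h => (hpred k ε h).cesaro.of_sub_tendsto_zero (hω v k)
  have hfar : ∀ m, EventuallyWithin (fun n : ℕ =>
      (∑ j ∈ Finset.range n, nStep R (m + 1) (Z j ω) v) / n) (π v) (C * ρ ^ (m + 1)) :=
    fun m => EventuallyWithin.cesaro fun δ hδ => Eventually.of_forall fun j =>
      (hbound (m + 1) (by omega) _ v).trans hδ.le
  -- Here `k` counts descents from level `m + 1`; truncated subtraction makes the claim stationary
  -- once level `0` is reached.
  have hnear : ∀ m k, EventuallyWithin (fun n : ℕ =>
      (∑ j ∈ Finset.range n, nStep R (m + 1 - k) (Z j ω) v) / n) (π v) (C * ρ ^ (m + 1)) := by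
    intro m k
    induction k with
    | zero => exact hfar m
    | succ k ih =>
      rcases Nat.eq_zero_or_pos (m + 1 - k) with h0 | h0
      · rwa [show m + 1 - (k + 1) = m + 1 - k by omega]
      · refine hback _ _ ?_
        rwa [show m + 1 - (k + 1) + 1 = m + 1 - k by omega]
  have hpow : Tendsto (fun m : ℕ => C * ρ ^ (m + 1)) atTop (𝓝 0) := by
    have := ((tendsto_pow_atTop_nhds_zero_of_lt_one hρ0.le hρ1).comp
      (tendsto_add_atTop_nat 1)).const_mul C
    simpa [Function.comp_def] using this
  have havg : ∀ m, EventuallyWithin (fun n : ℕ =>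
      (∑ j ∈ Finset.range n, nStep R 1 (Z j ω) v) / n) (π v) (C * ρ ^ (m + 1)) := fun m => by
    simpa using hnear m m
  have hU : Tendsto (fun n : ℕ => (∑' w, U n ω w * nStep R 0 w v) / ((n : ℝ) + t))
      atTop (𝓝 (π v)) :=
    tendsto_of_eventuallyWithin hpow fun m => hpred 0 _ (havg m)
  have hN : Tendsto (fun n : ℕ => (∑ j ∈ Finset.range n, nStep R 0 (Z j ω) v) / n)
      atTop (𝓝 (π v)) :=
    tendsto_of_eventuallyWithin hpow fun m => hback 0 _ (havg m)
  constructor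
  · simpa [nStep] using hU
  -- `drawCount Z n` counts `n + 1` draws, hence the shift.
  · have h1 := hN.comp (tendsto_add_atTop_nat 1)
    refine h1.congr fun n => ?_
    simp [drawCount, nStep, Set.indicator_apply]

end Urn

/-! ### Total masses and conclusion. -/

theorem hasSum_drawCount {S Ω : Type*} (Z : ℕ → Ω → S) (n : ℕ) (ω : Ω) :
    HasSum (fun v => drawCount Z n v ω) ((n : ℝ) + 1) := by
  classical
  have h1 : ∀ k, HasSum (fun v => (Z k ⁻¹' {v}).indicator (fun _ => (1 : ℝ)) ω) 1 := fun k => by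
    have h2 := hasSum_single (f := fun v => (Z k ⁻¹' {v}).indicator (fun _ => (1 : ℝ)) ω) (Z k ω)
      fun v hv => by simp [Ne.symm hv]
    simpa using h2
  simpa [drawCount] using hasSum_sum (s := Finset.range (n + 1)) fun k _ => h1 k

theorem theorem1 {S : Type*} [Countable S] [MeasurableSpace S] [DiscreteMeasurableSpace S]
    {Ω : Type*} [MeasurableSpace Ω] (P : Measure Ω) [IsProbabilityMeasure P]
    (R : Matrix S S ℝ) (π : S → ℝ)
    (hR : IsStochasticMatrix R) (hirr : R.IsIrreducible) (haper : IsAperiodicMatrix R)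
    (hrec : IsPositiveRecurrent R) (hπ : IsStationaryDistribution R π)
    (herg : IsUniformlyErgodic R π)
    (U₀ : S → ℝ) (t : ℝ) (hU₀ : ∀ v, 0 ≤ U₀ v) (ht : 0 < t) (hU₀t : HasSum U₀ t)
    (U : ℕ → Ω → S → ℝ) (Z : ℕ → Ω → S) (hUrn : IsUrnProcess P R U₀ t U Z) :
    (∀ᵐ ω ∂P,
      (∀ v, Tendsto (fun n : ℕ => U n ω v / ((n : ℝ) + t)) atTop (𝓝 (π v))) ∧
      TendstoL1 (fun n v => U n ω v / ((n : ℝ) + t)) π) ∧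
    (∀ᵐ ω ∂P,
      (∀ v, Tendsto (fun n : ℕ => drawCount Z n v ω / ((n : ℝ) + 1)) atTop (𝓝 (π v))) ∧
      TendstoL1 (fun n v => drawCount Z n v ω / ((n : ℝ) + 1)) π) := by
  have h := hUrn.ae_tendsto hR hU₀ ht hU₀t herg
  constructor
  · filter_upwards [h] with ω hω
    refine ⟨fun v => (hω v).1, tendstoL1_of_tendsto (fun n v => ?_) (fun n => ?_) hπ.nonneg
      hπ.hasSum_one fun v => (hω v).1⟩
    · exact div_nonneg (hUrn.nonneg hR hU₀ n ω v) (by positivity)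
    · have h1 := (hUrn.hasSum hR hU₀t n ω).div_const ((n : ℝ) + t)
      rwa [div_self (by positivity)] at h1
  · filter_upwards [h] with ω hω
    refine ⟨fun v => (hω v).2, tendstoL1_of_tendsto (fun n v => ?_) (fun n => ?_) hπ.nonneg
      hπ.hasSum_one fun v => (hω v).2⟩
    · exact div_nonneg (Finset.sum_nonneg fun k _ => Set.indicator_nonneg (by simp) _)
        (by positivity)
    · have h1 := (hasSum_drawCount Z n ω).div_const ((n : ℝ) + 1)
      rwa [div_self (by positivity)] at h1
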